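/- Theorem 2.3. Fix $R\ge 1$. For $f\in L^2(\mathbb R^3;\mathbb C)$ with support in the ball $B(0,R)$, a direction $\hat x\in\mathbb S^2$ and $k\in\mathbb R$, let $$u^\infty(\hat x,k)=\int_{\mathbb R^3}e^{-ik\,\hat x\cdot y}f(y)\,dy .$$ For $k>0$ this is the far-field pattern of the radiating solution $u(x)=\int_{\mathbb R^3}\frac{e^{ik|x-y|}}{4\pi|x-y|}f(y)\,dy$ of $\Delta u+k^2u=-f$. There is a strictly increasing function $\gamma:(0,\tfrac12]\to(0,1)$, depending only on $R$, and for every $M>0$ there is a function $C:(0,\tfrac12]\to(0,\infty)$, depending only on $R$ and $M$, such that the following holds. For every $f$ as above with $\|f\|_{L^1(\mathbb R^3)}\le M$, every $\hat x_0\in\mathbb S^2$, every $K>0$ and every $a\ge\max\{2K,1\}$, with $\gamma=\gamma(K/a)$ and $C=C(K/a)$, $$\|u^\infty(\hat x_0,\cdot)\|_{L^\infty(-a,a)}\le C\,e^{a(1-\gamma)}\,\|u^\infty(\hat x_0,\cdot)\|_{L^\infty(0,K)}^{\gamma}.$$ In particular $C$ and $\gamma$ depend on $K$ and $a$ only through $K/a$,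 and $\gamma$ increases as $K/a$ increases. -/

import Mathlib

open MeasureTheory Set
open scoped ENNReal

/-- Euclidean three-space. -/
abbrev E3 : Type := EuclideanSpace ℝ (Fin 3)

/-- The outgoing free-space Green function of `Δ + k²` in `ℝ³`,
`G(x, y, k) = exp(i k |x - y|) / (4 π |x - y|)`. -/
noncomputable def greenFunction (k : ℝ) (x y : E3) : ℂ :=
  Complex.exp (Complex.I * k * ‖x - y‖) / (4 * Real.pi * ‖x - y‖)

/-- The field radiated by the source `f` at wavenumber `k`, that is, the radiating solution
`u(x) = ∫ G(x, y, k) f(y) dy` of `Δ u + k² u = - f`. -/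
noncomputable def radiatedField (f : E3 → ℂ) (k : ℝ) (x : E3) : ℂ :=
  ∫ y, greenFunction k x y * f y

/-- The far-field pattern `u^∞(θ, k) = ∫ exp(-i k θ · y) f(y) dy` of the source `f` in the
direction `θ`; this formula makes sense for every real `k`. -/
noncomputable def farField (f : E3 → ℂ) (θ : E3) (k : ℝ) : ℂ :=
  ∫ y, Complex.exp (-(Complex.I * k * (inner ℝ θ y : ℝ))) * f y

/-- The class of sources: (representatives of) functions in `L²(ℝ³)`, complex valued, with
(essential) support in the ball of radius `R` about the origin. -/
structure IsSource (R : ℝ) (f : E3 → ℂ) : Prop where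
  memLp : MemLp f 2 volume
  supp : ∀ᵐ y ∂(volume : Measure E3), R ≤ ‖y‖ → f y = 0

theorem IsSource.integrable {R : ℝ} {f : E3 → ℂ} (hf : IsSource R f) : Integrable f volume := by
  have h1 : IntegrableOn f (Metric.ball 0 R) volume := by
    have : IsFiniteMeasure (volume.restrict (Metric.ball (0 : E3) R)) :=
      ⟨by rw [Measure.restrict_apply_univ]; exact measure_ball_lt_top⟩
    exact (hf.memLp.restrict _).integrable (by norm_num)
  refine h1.integrable_of_ae_notMem_eq_zero ?_
  filter_upwards [hf.supp] with y hy hy'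
  exact hy (by simpa using hy')

theorem farField_kernel_bound {R k : ℝ} (hR : 0 < R) {x y : E3} (hx : 2 * R ≤ ‖x‖)
    (hy : ‖y‖ ≤ R) :
    ‖(4 * Real.pi * ‖x‖ : ℂ) * Complex.exp (-(Complex.I * k * ‖x‖)) * greenFunction k x y
      - Complex.exp (-(Complex.I * k * (inner ℝ (‖x‖⁻¹ • x) y : ℝ)))‖
      ≤ (2 * R + 2 * |k| * R ^ 2) / ‖x‖ := by
  set r := ‖x‖ with hr
  set d := ‖x - y‖ with hd
  set s : ℝ := inner ℝ (r⁻¹ • x) y with hs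
  have hr0 : 0 < r := by linarith
  have hdr : |d - r| ≤ ‖y‖ := by
    have := abs_norm_sub_norm_le (x - y) x
    simpa using this
  have hd2 : r / 2 ≤ d := by have := (abs_le.1 hdr).1; linarith
  have hd0 : 0 < d := by linarith
  have hsy : |s| ≤ ‖y‖ := by
    have h := abs_real_inner_le_norm (r⁻¹ • x) y
    have h1 : ‖r⁻¹ • x‖ = 1 := by
      rw [norm_smul, norm_inv, Real.norm_of_nonneg hr0.le, ← hr]
      exact inv_mul_cancel₀ hr0.ne'
    rw [h1, one_mul] at h
    exact h
  have hin : inner ℝ x y = r * s := by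
    rw [hs, real_inner_smul_left, ← mul_assoc, mul_inv_cancel₀ hr0.ne', one_mul]
  have hsq : d ^ 2 = r ^ 2 - 2 * (r * s) + ‖y‖ ^ 2 := by
    rw [hd, norm_sub_sq_real, hin]
  have hphase : |d - r + s| ≤ 2 * R ^ 2 / r := by
    have e : (d - r + s) * (d + r) = ‖y‖ ^ 2 + s * (d - r) := by linear_combination hsq
    have h1 : |d - r + s| * (d + r) ≤ 2 * R ^ 2 := by
      have h2 : |d - r + s| * (d + r) = |(d - r + s) * (d + r)| := by
        rw [abs_mul, abs_of_pos (by linarith : 0 < d + r)]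
      rw [h2, e]
      have h3 : |s * (d - r)| ≤ R * R := by
        rw [abs_mul]
        exact mul_le_mul (hsy.trans hy) (hdr.trans hy) (abs_nonneg _) hR.le
      have h4 : ‖y‖ ^ 2 ≤ R ^ 2 := by gcongr
      have h5 := abs_add_le (‖y‖ ^ 2) (s * (d - r))
      rw [abs_of_nonneg (sq_nonneg ‖y‖)] at h5
      nlinarith
    rw [le_div_iff₀ hr0]
    nlinarith [abs_nonneg (d - r + s)]
  have hpi : (Real.pi : ℂ) ≠ 0 := by exact_mod_cast Real.pi_ne_zero
  have hdC : (d : ℂ) ≠ 0 := by exact_mod_cast hd0.ne'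
  have key : (4 * Real.pi * r : ℂ) * Complex.exp (-(Complex.I * k * r)) * greenFunction k x y
      - Complex.exp (-(Complex.I * k * s))
      = ((r - d) / d : ℝ) * Complex.exp ((k * (d - r) : ℝ) * Complex.I)
        + Complex.exp ((-(k * s) : ℝ) * Complex.I)
          * (Complex.exp (Complex.I * (k * (d - r + s) : ℝ)) - 1) := by
    have e1 : Complex.exp (-(Complex.I * k * r)) * Complex.exp (Complex.I * k * d)
        = Complex.exp ((k * (d - r) : ℝ) * Complex.I) := by
      rw [← Complex.exp_add]; congr 1; push_cast; ring
    have e2 : Complex.exp ((-(k * s) : ℝ) * Complex.I)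
          * Complex.exp (Complex.I * (k * (d - r + s) : ℝ))
        = Complex.exp ((k * (d - r) : ℝ) * Complex.I) := by
      rw [← Complex.exp_add]; congr 1; push_cast; ring
    have e3 : Complex.exp (-(Complex.I * k * s)) = Complex.exp ((-(k * s) : ℝ) * Complex.I) := by
      congr 1; push_cast; ring
    rw [mul_sub (Complex.exp _), e2, e3, greenFunction, ← hd, ← e1]
    push_cast
    field_simp
    ring
  rw [key]
  refine (norm_add_le _ _).trans ?_
  rw [norm_mul, norm_mul, Complex.norm_exp_ofReal_mul_I, Complex.norm_exp_ofReal_mul_I, mul_one,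
    one_mul, Complex.norm_real, add_div]
  refine add_le_add ?_ ?_
  · rw [Real.norm_eq_abs, abs_div, abs_of_pos hd0, abs_sub_comm, div_le_div_iff₀ hd0 hr0]
    have := hdr.trans hy
    nlinarith [abs_nonneg (d - r)]
  · refine (Real.norm_exp_I_mul_ofReal_sub_one_le).trans ?_
    rw [Real.norm_eq_abs, abs_mul]
    calc |k| * |d - r + s| ≤ |k| * (2 * R ^ 2 / r) := by gcongr
      _ = 2 * |k| * R ^ 2 / r := by ring

/-- `farField` is the amplitude in the far-field expansion of the radiated field:
`u(x) = exp(i k |x|) / (4 π |x|) * (u^∞(x/|x|, k) + O(1/|x|))`, uniformly in all directions. -/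
theorem radiatedField_asymptotics {R : ℝ} (hR : 0 < R) {f : E3 → ℂ} (hf : IsSource R f) (k : ℝ) :
    ∃ C : ℝ, ∀ x : E3, 2 * R ≤ ‖x‖ →
      ‖(4 * Real.pi * ‖x‖ : ℂ) * Complex.exp (-(Complex.I * k * ‖x‖)) * radiatedField f k x
        - farField f (‖x‖⁻¹ • x) k‖ ≤ C / ‖x‖ := by
  have hint := hf.integrable
  refine ⟨(2 * R + 2 * |k| * R ^ 2) * ∫ y, ‖f y‖, fun x hx => ?_⟩
  have hr0 : 0 < ‖x‖ := by linarith
  set A : ℂ := (4 * Real.pi * ‖x‖ : ℂ) * Complex.exp (-(Complex.I * k * ‖x‖)) with hA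
  set B : ℝ := (2 * R + 2 * |k| * R ^ 2) / ‖x‖ with hB
  have hi2 : Integrable (fun y => Complex.exp (-(Complex.I * k * (inner ℝ (‖x‖⁻¹ • x) y : ℝ)))
      * f y) volume := by
    refine hint.bdd_mul (c := 1) (Continuous.aestronglyMeasurable (by fun_prop)) ?_
    refine Filter.Eventually.of_forall fun y => ?_
    have : -(Complex.I * k * (inner ℝ (‖x‖⁻¹ • x) y : ℝ))
        = ((-(k * inner ℝ (‖x‖⁻¹ • x) y) : ℝ) : ℂ) * Complex.I := by push_cast; ring
    rw [this, Complex.norm_exp_ofReal_mul_I]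
  have hb : ∀ᵐ y ∂(volume : Measure E3), ‖A * (greenFunction k x y * f y)
      - Complex.exp (-(Complex.I * k * (inner ℝ (‖x‖⁻¹ • x) y : ℝ))) * f y‖ ≤ B * ‖f y‖ := by
    filter_upwards [hf.supp] with y hy
    rcases le_or_gt R ‖y‖ with h | h
    · simp [hy h]
    · rw [← mul_assoc, ← sub_mul, norm_mul]
      exact mul_le_mul_of_nonneg_right (farField_kernel_bound hR hx h.le) (norm_nonneg _)
  have hmeas : AEStronglyMeasurable (fun y => A * (greenFunction k x y * f y)) volume := by
    refine (AEStronglyMeasurable.mul ?_ hint.1).const_mul A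
    refine Measurable.aestronglyMeasurable ?_
    unfold greenFunction
    fun_prop
  have hd : Integrable (fun y => A * (greenFunction k x y * f y)
      - Complex.exp (-(Complex.I * k * (inner ℝ (‖x‖⁻¹ • x) y : ℝ))) * f y) volume :=
    (hint.norm.const_mul B).mono' (hmeas.sub hi2.1) hb
  have hi1 : Integrable (fun y => A * (greenFunction k x y * f y)) volume := by
    refine (hd.add hi2).congr (Filter.Eventually.of_forall fun y => ?_)
    simp only [Pi.add_apply, sub_add_cancel]
  rw [radiatedField, farField, ← integral_const_mul, ← integral_sub hi1 hi2]
  refine (norm_integral_le_of_norm_le (hint.norm.const_mul B) hb).trans (le_of_eq ?_)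
  rw [integral_const_mul, hB]
  ring

/-! The far field extends to an entire function of the wavenumber, bounded by `exp (R |Im z|) *
‖f‖₁` because `f` lives in the ball of radius `R`. Put `G z = u^∞(a z + K/2)`. On the strip `|Im z|
≤ 1/R` it is at most `B = max M 1 * exp a`, it is small for `|x| ≤ t/2` with `t = K/a`, and `|x| ≤
3/2` covers all wavenumbers in `(-a, a)`.

`exists_strip_exponent` then interpolates between the small bound `e` and `B`, with an exponent `q`
fixed by `R` and `t` alone, since the geometry of strip and segments involves nothing else. From `e
^ q * B ^ (1 - q)` comes the factor `exp (a (1 - q))`. Finally `exists_strictMonoOn_le_of_Ioc`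
trades `q` for a strictly increasing exponent, which is harmless because lowering the exponent only
weakens the bound (`rpow_interp_anti`). -/

/-! ### Conformal map from the disc to the strip -/

/-- The conformal map `w ↦ (2 h / π) log ((1 + w) / (1 - w))` of the unit disc onto the strip
`|Im z| < h`. -/
noncomputable def discToStrip (h : ℝ) (w : ℂ) : ℂ :=
  (2 * h / Real.pi : ℝ) * Complex.log ((1 + w) / (1 - w))

theorem cayley_re_pos {w : ℂ} (hw : ‖w‖ < 1) : 0 < ((1 + w) / (1 - w)).re := by
  have hne : 1 - w ≠ 0 := by
    intro h
    have : w = 1 := (sub_eq_zero.1 h).symm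
    simp [this] at hw
  have hn : 0 < Complex.normSq (1 - w) := Complex.normSq_pos.2 hne
  have hs : w.re * w.re + w.im * w.im < 1 := by
    have h1 : Complex.normSq w < 1 := by
      rw [Complex.normSq_eq_norm_sq]
      nlinarith [norm_nonneg w]
    rwa [Complex.normSq_apply] at h1
  rw [Complex.div_re, ← add_div]
  refine div_pos ?_ hn
  simp
  nlinarith

theorem differentiableAt_discToStrip (h : ℝ) {w : ℂ} (hw : ‖w‖ < 1) :
    DifferentiableAt ℂ (discToStrip h) w := by
  have hne : 1 - w ≠ 0 := by
    intro h
    have : w = 1 := (sub_eq_zero.1 h).symm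
    simp [this] at hw
  unfold discToStrip
  have hq : DifferentiableAt ℂ (fun w : ℂ => (1 + w) / (1 - w)) w :=
    DifferentiableAt.div (by fun_prop) (by fun_prop) hne
  exact (hq.clog (Or.inl (cayley_re_pos hw))).const_mul _

theorem abs_im_discToStrip_le {h : ℝ} (hh : 0 ≤ h) {w : ℂ} (hw : ‖w‖ < 1) :
    |(discToStrip h w).im| ≤ h := by
  have harg := Complex.abs_arg_lt_pi_div_two_iff.2 (Or.inl (cayley_re_pos hw))
  rw [discToStrip, Complex.im_ofReal_mul, Complex.log_im, abs_mul,
    abs_of_nonneg (by positivity : 0 ≤ 2 * h / Real.pi)]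
  calc 2 * h / Real.pi * |Complex.arg ((1 + w) / (1 - w))|
      ≤ 2 * h / Real.pi * (Real.pi / 2) := by gcongr
    _ = h := by field_simp

theorem discToStrip_ofReal (h : ℝ) {y : ℝ} (hy : y ∈ Ioo (-1 : ℝ) 1) :
    discToStrip h y = ((4 * h / Real.pi) * Real.artanh y : ℝ) := by
  have hpos : 0 ≤ (1 + y) / (1 - y) := div_nonneg (by linarith [hy.1]) (by linarith [hy.2])
  rw [discToStrip, Real.artanh_eq_half_log (Ioo_subset_Icc_self hy)]
  push_cast
  rw [Complex.ofReal_log hpos]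
  push_cast
  ring

/-! ### Propagation of smallness in a strip -/

theorem norm_cosh_le_cosh_re (s : ℂ) : ‖Complex.cosh s‖ ≤ Real.cosh s.re := by
  rw [Complex.cosh, Real.cosh_eq, norm_div, Complex.norm_ofNat]
  gcongr
  refine (norm_add_le _ _).trans ?_
  simp [Complex.norm_exp]

theorem tanh_le_tanh {x y : ℝ} (h : x ≤ y) : Real.tanh x ≤ Real.tanh y := by
  rwa [← Real.artanh_le_artanh_iff ⟨Real.neg_one_lt_tanh x, Real.tanh_lt_one x⟩
    ⟨Real.neg_one_lt_tanh y, Real.tanh_lt_one y⟩, Real.artanh_tanh, Real.artanh_tanh]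

theorem tanh_lt_tanh {x y : ℝ} (h : x < y) : Real.tanh x < Real.tanh y := by
  rwa [← Real.artanh_lt_artanh_iff ⟨Real.neg_one_lt_tanh x, Real.tanh_lt_one x⟩
    ⟨Real.neg_one_lt_tanh y, Real.tanh_lt_one y⟩, Real.artanh_tanh, Real.artanh_tanh]

/-- Lowering the exponent moves weight from the smaller number `e` to the larger number `B`. -/
theorem rpow_interp_anti {e B p q : ℝ} (he : 0 ≤ e) (hB : e ≤ B) (hB0 : 0 < B) (hq : 0 ≤ q)
    (hqp : q ≤ p) : e ^ p * B ^ (1 - p) ≤ e ^ q * B ^ (1 - q) := by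
  have h1 : e ^ p = e ^ q * e ^ (p - q) := by
    rw [← Real.rpow_add_of_nonneg he hq (by linarith)]
    congr 1; ring
  have h2 : B ^ (1 - q) = B ^ (p - q) * B ^ (1 - p) := by
    rw [← Real.rpow_add hB0]; congr 1; ring
  rw [h1, h2, ← mul_assoc]
  gcongr

/-- Smallness of an entire function on a real segment propagates along the real axis, at a rate
which does not depend on the bound in the strip. The proof applies the three lines theorem after
the substitution `s ↦ discToStrip h (b cosh s)`, which maps the imaginary axis onto the segment. -/
theorem exists_strip_exponent {h r L : ℝ} (hh : 0 < h) (hr : 0 < r) (hrL : r < L) :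
    ∃ q ∈ Ioo (0 : ℝ) 1, ∀ (G : ℂ → ℂ), Differentiable ℂ G → ∀ e B : ℝ, 0 ≤ e → e ≤ B → 0 < B →
      (∀ z : ℂ, |z.im| ≤ h → ‖G z‖ ≤ B) → (∀ x : ℝ, |x| ≤ r → ‖G x‖ ≤ e) →
      ∀ x : ℝ, |x| ≤ L → ‖G x‖ ≤ e ^ q * B ^ (1 - q) := by
  have hpi := Real.pi_pos
  set A : ℝ := 4 * h / Real.pi with hA
  have hA0 : 0 < A := by positivity
  set b := Real.tanh (r / A) with hb
  set Y := Real.tanh (L / A) with hY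
  have hb0 : 0 < b := by
    have := tanh_lt_tanh (div_pos hr hA0)
    rwa [Real.tanh_zero] at this
  have hbY : b < Y := tanh_lt_tanh (by gcongr)
  have hY1 : Y < 1 := Real.tanh_lt_one _
  set S := Real.arcosh (Y / b) with hS
  -- The midpoint of `Y` and `1` keeps the image of the closed strip `0 ≤ re s ≤ σ` inside the disc,
  -- while `S < σ` leaves a positive exponent.
  set σ := Real.arcosh (((1 + Y) / 2) / b) with hσ
  have hYb : 1 < Y / b := (one_lt_div hb0).2 hbY
  have hYb' : Y / b < ((1 + Y) / 2) / b := by gcongr; linarith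
  have hS0 : 0 < S := Real.arcosh_pos hYb
  have hSσ : S < σ := (Real.arcosh_lt_arcosh (by linarith) (by linarith)).2 hYb'
  have hσ0 : 0 < σ := hS0.trans hSσ
  have hcσ : b * Real.cosh σ = (1 + Y) / 2 := by
    rw [hσ, Real.cosh_arcosh (by linarith)]; field_simp
  have hdisc : ∀ s : ℂ, s.re ∈ Icc 0 σ → ‖(b : ℂ) * Complex.cosh s‖ < 1 := by
    intro s hs
    rw [norm_mul, Complex.norm_real, Real.norm_of_nonneg hb0.le]
    calc b * ‖Complex.cosh s‖ ≤ b * Real.cosh σ := by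
          gcongr
          refine (norm_cosh_le_cosh_re s).trans (Real.cosh_le_cosh.2 ?_)
          rw [abs_of_nonneg hs.1, abs_of_nonneg hσ0.le]
          exact hs.2
      _ < 1 := by rw [hcσ]; linarith
  refine ⟨1 - S / σ, ⟨by rw [sub_pos, div_lt_one hσ0]; exact hSσ, by
    have := div_pos hS0 hσ0; linarith⟩, ?_⟩
  have hq0 : 0 ≤ 1 - S / σ := by rw [sub_nonneg, div_le_one hσ0]; exact hSσ.le
  have hq1 : 1 - S / σ ≤ 1 := by have := div_pos hS0 hσ0; linarith
  have main : ∀ (G : ℂ → ℂ), Differentiable ℂ G → ∀ e B : ℝ, 0 ≤ e → e ≤ B → 0 < B →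
      (∀ z : ℂ, |z.im| ≤ h → ‖G z‖ ≤ B) → (∀ x : ℝ, |x| ≤ r → ‖G x‖ ≤ e) →
      ∀ x : ℝ, r ≤ x → x ≤ L → ‖G x‖ ≤ e ^ (1 - S / σ) * B ^ (1 - (1 - S / σ)) := by
    intro G hG e B he heB hB hGB hGe x hrx hxL
    set H : ℂ → ℂ := fun s => G (discToStrip h (b * Complex.cosh s)) with hH
    have hHB : ∀ s : ℂ, s.re ∈ Icc 0 σ → ‖H s‖ ≤ B := fun s hs =>
      hGB _ (abs_im_discToStrip_le hh.le (hdisc s hs))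
    have hHd : DifferentiableOn ℂ H (Complex.HadamardThreeLines.verticalClosedStrip 0 σ) := by
      intro s hs
      refine DifferentiableAt.differentiableWithinAt ?_
      refine DifferentiableAt.comp s hG.differentiableAt ?_
      refine DifferentiableAt.comp (g := discToStrip h) s
        (differentiableAt_discToStrip h (hdisc s hs)) ?_
      exact (Complex.differentiable_cosh s).const_mul _
    have hd : DiffContOnCl ℂ H (Complex.HadamardThreeLines.verticalStrip 0 σ) := by
      refine DifferentiableOn.diffContOnCl ?_
      rw [Complex.HadamardThreeLines.verticalStrip, Complex.closure_preimage_re,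
        closure_Ioo hσ0.ne]
      exact hHd
    -- On the imaginary axis `cosh` becomes `cos`, so `b cosh s` stays in `[-b, b]`, the preimage of
    -- `[-r, r]`.
    have hleft : ∀ s ∈ Complex.re ⁻¹' {(0 : ℝ)}, ‖H s‖ ≤ e := by
      intro s hs
      have hs' : s = (s.im : ℂ) * Complex.I := by
        apply Complex.ext <;> simp
        exact hs
      have hcos : (b : ℂ) * Complex.cosh s = ((b * Real.cos s.im : ℝ) : ℂ) := by
        rw [hs', Complex.cosh_mul_I]; simp
      have h1 : |b * Real.cos s.im| ≤ b := by
        rw [abs_mul, abs_of_pos hb0]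
        exact mul_le_of_le_one_right hb0.le (Real.abs_cos_le_one _)
      have h2 := abs_le.1 h1
      have hb1 : b < 1 := hbY.trans hY1
      have hin : b * Real.cos s.im ∈ Ioo (-1 : ℝ) 1 := ⟨by linarith, by linarith⟩
      rw [hH]
      simp only
      rw [hcos, discToStrip_ofReal h hin]
      refine hGe _ ?_
      rw [abs_mul, ← hA, abs_of_pos hA0, ← le_div_iff₀' hA0, abs_le]
      constructor
      · have : Real.artanh (Real.tanh (-(r / A))) ≤ Real.artanh (b * Real.cos s.im) :=
          Real.artanh_le_artanh (Real.neg_one_lt_tanh _) hin.2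
            (by rw [Real.tanh_neg]; exact h2.1)
        rwa [Real.artanh_tanh] at this
      · have : Real.artanh (b * Real.cos s.im) ≤ Real.artanh (Real.tanh (r / A)) :=
          Real.artanh_le_artanh hin.1 (Real.tanh_lt_one _) h2.2
        rwa [Real.artanh_tanh] at this
    have hy1 : b ≤ Real.tanh (x / A) := tanh_le_tanh (by gcongr)
    have hy2 : Real.tanh (x / A) ≤ Y := tanh_le_tanh (by gcongr)
    set s := Real.arcosh (Real.tanh (x / A) / b) with hs
    have hyb : 1 ≤ Real.tanh (x / A) / b := (one_le_div hb0).2 hy1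
    have hs0 : 0 ≤ s := Real.arcosh_nonneg hyb
    have hsS : s ≤ S :=
      (Real.arcosh_le_arcosh (by linarith) (by linarith)).2 (by gcongr)
    have hHs : H s = G x := by
      have hc : b * Real.cosh s = Real.tanh (x / A) := by
        rw [hs, Real.cosh_arcosh hyb]; field_simp
      rw [hH]
      simp only
      rw [← Complex.ofReal_cosh, ← Complex.ofReal_mul, hc, discToStrip_ofReal h
        ⟨Real.neg_one_lt_tanh _, Real.tanh_lt_one _⟩, Real.artanh_tanh, ← hA,
        mul_div_cancel₀ _ hA0.ne']
    have h3 := Complex.HadamardThreeLines.norm_le_interp_of_mem_verticalClosedStrip'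
      (z := (s : ℂ)) (a := e) (b := B) hσ0
      (show (s : ℂ).re ∈ Icc 0 σ from ⟨by simpa using hs0, by simpa using hsS.trans hSσ.le⟩) hd
      ⟨B, by rintro _ ⟨w, hw, rfl⟩; exact hHB w hw⟩ hleft
      (fun w hw => hHB w (by rw [show w.re = σ from hw]; exact ⟨hσ0.le, le_rfl⟩))
    rw [hHs, Complex.ofReal_re, sub_zero, sub_zero] at h3
    -- Three lines gives an exponent depending on `x`; the one for `x = L` is the worst.
    have h4 := rpow_interp_anti (p := 1 - s / σ) he heB hB hq0
      (by gcongr)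
    rw [sub_sub_cancel 1 (s / σ)] at h4
    exact h3.trans h4
  intro G hG e B he heB hB hGB hGe x hx
  rcases le_total |x| r with h1 | h1
  · refine (hGe x h1).trans ?_
    have h5 := rpow_interp_anti (p := 1) he heB hB hq0 hq1
    simpa using h5
  · rcases abs_cases x with ⟨h2, -⟩ | ⟨h2, -⟩
    · exact main G hG e B he heB hB hGB hGe x (h2 ▸ h1) (h2 ▸ hx)
    · have := main (fun z => G (-z)) (hG.comp differentiable_neg) e B he heB hB
        (fun z hz => hGB _ (by simpa using hz))
        (fun y hy => by simpa using hGe (-y) (by simpa using hy)) (-x) (h2 ▸ h1) (h2 ▸ hx)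
      simpa using this

/-! ### Entire continuation of the far field -/

/-- The far-field pattern continued to complex wavenumbers. -/
noncomputable def complexFarField (f : E3 → ℂ) (θ : E3) (z : ℂ) : ℂ :=
  ∫ y, Complex.exp (-(Complex.I * z * (inner ℝ θ y : ℝ))) * f y

theorem complexFarField_ofReal (f : E3 → ℂ) (θ : E3) (k : ℝ) :
    complexFarField f θ k = farField f θ k := rfl

theorem norm_exp_neg_I_mul_le {R : ℝ} (z : ℂ) {c : ℝ} (hc : |c| ≤ R) :
    ‖Complex.exp (-(Complex.I * z * c))‖ ≤ Real.exp (R * |z.im|) := by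
  rw [Complex.norm_exp]
  gcongr
  have h1 : (-(Complex.I * z * c)).re = c * z.im := by simp [mul_comm]
  rw [h1]
  refine (le_abs_self _).trans ?_
  rw [abs_mul]
  gcongr

/-- One null set serves all `z`, as differentiation under the integral requires. -/
theorem IsSource.norm_exp_mul_le {R : ℝ} {f : E3 → ℂ} (hf : IsSource R f) {θ : E3}
    (hθ : ‖θ‖ = 1) : ∀ᵐ y ∂(volume : Measure E3), ∀ z : ℂ,
      ‖Complex.exp (-(Complex.I * z * (inner ℝ θ y : ℝ))) * f y‖
        ≤ Real.exp (R * |z.im|) * ‖f y‖ := by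
  filter_upwards [hf.supp] with y hy z
  rcases le_or_gt R ‖y‖ with h | h
  · simp [hy h]
  · rw [norm_mul]
    gcongr
    refine norm_exp_neg_I_mul_le z ((abs_real_inner_le_norm θ y).trans ?_)
    rw [hθ, one_mul]
    exact h.le

theorem IsSource.norm_complexFarField_le {R : ℝ} {f : E3 → ℂ} (hf : IsSource R f) {θ : E3}
    (hθ : ‖θ‖ = 1) (z : ℂ) :
    ‖complexFarField f θ z‖ ≤ Real.exp (R * |z.im|) * ∫ y, ‖f y‖ := by
  rw [complexFarField, ← integral_const_mul]
  exact norm_integral_le_of_norm_le (hf.integrable.norm.const_mul _)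
    ((hf.norm_exp_mul_le hθ).mono fun y hy => hy z)

theorem IsSource.differentiable_complexFarField {R : ℝ} (hR : 0 ≤ R) {f : E3 → ℂ}
    (hf : IsSource R f) {θ : E3} (hθ : ‖θ‖ = 1) : Differentiable ℂ (complexFarField f θ) := by
  intro z₀
  have hint := hf.integrable
  have hmeas : ∀ z : ℂ, AEStronglyMeasurable
      (fun y : E3 => Complex.exp (-(Complex.I * z * (inner ℝ θ y : ℝ))) * f y) volume := fun z =>
    (Continuous.aestronglyMeasurable (by fun_prop)).mul hint.1
  refine (hasDerivAt_integral_of_dominated_loc_of_deriv_le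
    (F := fun (z : ℂ) (y : E3) => Complex.exp (-(Complex.I * z * (inner ℝ θ y : ℝ))) * f y)
    (F' := fun (z : ℂ) (y : E3) => (-(Complex.I * (inner ℝ θ y : ℝ))) *
      (Complex.exp (-(Complex.I * z * (inner ℝ θ y : ℝ))) * f y))
    (bound := fun y => R * (Real.exp (R * (‖z₀‖ + 1)) * ‖f y‖))
    (Metric.ball_mem_nhds z₀ one_pos) (.of_forall hmeas) ?_ ?_ ?_ ?_ ?_).2.differentiableAt
  · exact (hint.norm.const_mul _).mono' (hmeas z₀)
      ((hf.norm_exp_mul_le hθ).mono fun y hy => hy z₀)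
  · exact (Continuous.aestronglyMeasurable (by fun_prop)).mul (hmeas z₀)
  · filter_upwards [hf.norm_exp_mul_le hθ, hf.supp] with y hy hsupp z hz
    rcases le_or_gt R ‖y‖ with h | h
    · simp [hsupp h]
    · have h1 : |inner ℝ θ y| ≤ R := by
        refine (abs_real_inner_le_norm θ y).trans ?_
        rw [hθ, one_mul]
        exact h.le
      have h2 : |z.im| ≤ ‖z₀‖ + 1 := by
        refine (Complex.abs_im_le_norm z).trans ?_
        have := norm_sub_norm_le z z₀
        have hz' := mem_ball_iff_norm.1 hz
        linarith
      rw [norm_mul, norm_neg, norm_mul, Complex.norm_I, one_mul, Complex.norm_real,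
        Real.norm_eq_abs]
      refine mul_le_mul h1 ((hy z).trans ?_) (norm_nonneg _) hR
      gcongr
  · exact (hint.norm.const_mul _).const_mul _
  · refine .of_forall fun y z _ => ?_
    have h1 : HasDerivAt (fun z : ℂ => -(Complex.I * z * (inner ℝ θ y : ℝ)))
        (-(Complex.I * (inner ℝ θ y : ℝ))) z := by
      simpa using
        (((hasDerivAt_id z).const_mul Complex.I).mul_const ((inner ℝ θ y : ℝ) : ℂ)).fun_neg
    exact (h1.cexp.mul_const (f y)).congr_deriv (by ring)

/-! ### Essential suprema and monotone exponents -/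

/-- The set in the interval where the bound fails is open and null, hence empty; continuity adds the
endpoints. -/
theorem Continuous.enorm_le_eLpNorm_top_Ioo {F : ℝ → ℂ} (hF : Continuous F) {l u : ℝ}
    (hlu : l < u) {x : ℝ} (hx : x ∈ Icc l u) :
    ‖F x‖ₑ ≤ eLpNorm F ∞ (volume.restrict (Ioo l u)) := by
  set E := eLpNorm F ∞ (volume.restrict (Ioo l u)) with hE
  have hae : ∀ᵐ y ∂(volume.restrict (Ioo l u)), ‖F y‖ₑ ≤ E := by
    rw [hE, eLpNorm_exponent_top]
    exact ae_le_eLpNormEssSup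
  have hc : Continuous fun y => ‖F y‖ₑ := hF.enorm
  have hopen : IsOpen ({y | E < ‖F y‖ₑ} ∩ Ioo l u) :=
    (isOpen_lt continuous_const hc).inter isOpen_Ioo
  have hempty : {y | E < ‖F y‖ₑ} ∩ Ioo l u = ∅ := by
    rw [← hopen.measure_eq_zero_iff volume]
    rw [ae_restrict_iff' measurableSet_Ioo] at hae
    refine measure_mono_null (fun y hy => ?_) (ae_iff.1 hae)
    simp only [mem_ofPred_eq, not_forall, not_le]
    exact ⟨hy.2, hy.1⟩
  have hsub : Ioo l u ⊆ {y | ‖F y‖ₑ ≤ E} := fun y hy => by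
    by_contra h
    have hlt : E < ‖F y‖ₑ := by simpa using h
    have hmem : y ∈ {y | E < ‖F y‖ₑ} ∩ Ioo l u := ⟨hlt, hy⟩
    simp [hempty] at hmem
  have := closure_minimal hsub (isClosed_le hc continuous_const)
  rw [closure_Ioo hlu.ne] at this
  exact this hx

/-- Any function with values in `(0, 1)` can be replaced by a strictly increasing one whose value
at `t` stays below a value taken at some `s ≤ t`. -/
theorem exists_strictMonoOn_le_of_Ioc {q : ℝ → ℝ}
    (hq : ∀ t ∈ Ioc (0 : ℝ) (1 / 2), q t ∈ Ioo (0 : ℝ) 1) :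
    ∃ γ : ℝ → ℝ, StrictMonoOn γ (Ioc 0 (1 / 2)) ∧
      ∀ t ∈ Ioc (0 : ℝ) (1 / 2), γ t ∈ Ioo (0 : ℝ) 1 ∧ ∃ s ∈ Ioc 0 t, γ t ≤ q s := by
  have hbdd : ∀ t ∈ Ioc (0 : ℝ) (1 / 2), BddAbove (q '' Ioc 0 t) := by
    rintro t ht
    refine ⟨1, ?_⟩
    rintro _ ⟨s, hs, rfl⟩
    exact (hq s ⟨hs.1, hs.2.trans ht.2⟩).2.le
  have hpos : ∀ t ∈ Ioc (0 : ℝ) (1 / 2), 0 < sSup (q '' Ioc 0 t) := fun t ht =>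
    (hq t ht).1.trans_le (le_csSup (hbdd t ht) ⟨t, ⟨ht.1, le_rfl⟩, rfl⟩)
  have hex : ∀ t ∈ Ioc (0 : ℝ) (1 / 2), ∃ s ∈ Ioc 0 t, t * sSup (q '' Ioc 0 t) < q s := by
    intro t ht
    have h1 : t * sSup (q '' Ioc 0 t) < sSup (q '' Ioc 0 t) := by
      have := hpos t ht
      nlinarith [ht.2]
    obtain ⟨_, ⟨s, hs, rfl⟩, h2⟩ := exists_lt_of_lt_csSup
      (⟨q t, t, ⟨ht.1, le_rfl⟩, rfl⟩ : (q '' Ioc 0 t).Nonempty) h1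
    exact ⟨s, hs, h2⟩
  -- The running supremum is monotone; the factor `t` makes it strictly so and, being below `1`,
  -- puts it under an attained value.
  refine ⟨fun t => t * sSup (q '' Ioc 0 t), ?_, fun t ht => ⟨⟨mul_pos ht.1 (hpos t ht), ?_⟩, ?_⟩⟩
  · intro s hs t ht hst
    exact mul_lt_mul hst (csSup_le_csSup (hbdd t ht) ⟨q s, s, ⟨hs.1, le_rfl⟩, rfl⟩
      (image_mono (Ioc_subset_Ioc_right hst.le))) (hpos s hs) ht.1.le
  · obtain ⟨s, hs, h⟩ := hex t ht
    exact h.trans (hq s ⟨hs.1, hs.2.trans ht.2⟩).2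
  · obtain ⟨s, hs, h⟩ := hex t ht
    exact ⟨s, hs, h.le⟩

/-! ### Rescaling and conclusion -/

theorem theorem2p3 (R : ℝ) (hR : 1 ≤ R) :
    ∃ γ : ℝ → ℝ,
      StrictMonoOn γ (Ioc 0 (1 / 2)) ∧
      (∀ t ∈ Ioc (0 : ℝ) (1 / 2), γ t ∈ Ioo (0 : ℝ) 1) ∧
      ∀ M : ℝ, 0 < M →
        ∃ C : ℝ → ℝ,
          (∀ t ∈ Ioc (0 : ℝ) (1 / 2), 0 < C t) ∧
          ∀ (f : E3 → ℂ), IsSource R f → ∫ y, ‖f y‖ ≤ M →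
          ∀ (x₀ : E3), ‖x₀‖ = 1 →
          ∀ (K a : ℝ), 0 < K → max (2 * K) 1 ≤ a →
            eLpNorm (fun k : ℝ => farField f x₀ k) ∞ (volume.restrict (Ioo (-a) a)) ≤
              ENNReal.ofReal (C (K / a) * Real.exp (a * (1 - γ (K / a)))) *
                eLpNorm (fun k : ℝ => farField f x₀ k) ∞ (volume.restrict (Ioo 0 K))
                  ^ γ (K / a) := by
  have hR0 : 0 < R := by linarith
  have hexp : ∀ t : ℝ, ∃ q : ℝ, t ∈ Ioc (0 : ℝ) (1 / 2) → q ∈ Ioo (0 : ℝ) 1 ∧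
      ∀ (G : ℂ → ℂ), Differentiable ℂ G → ∀ e B : ℝ, 0 ≤ e → e ≤ B → 0 < B →
        (∀ z : ℂ, |z.im| ≤ R⁻¹ → ‖G z‖ ≤ B) → (∀ x : ℝ, |x| ≤ t / 2 → ‖G x‖ ≤ e) →
        ∀ x : ℝ, |x| ≤ 3 / 2 → ‖G x‖ ≤ e ^ q * B ^ (1 - q) := by
    intro t
    by_cases ht : t ∈ Ioc (0 : ℝ) (1 / 2)
    · obtain ⟨q, hq, h⟩ := exists_strip_exponent (h := R⁻¹) (r := t / 2) (L := 3 / 2)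
        (by positivity) (by linarith [ht.1]) (by linarith [ht.2])
      exact ⟨q, fun _ => ⟨hq, h⟩⟩
    · exact ⟨0, fun h => absurd h ht⟩
  choose q hq using hexp
  obtain ⟨γ, hmono, hγ⟩ := exists_strictMonoOn_le_of_Ioc fun t ht => (hq t ht).1
  -- The `1` in `max M 1` ensures that its power `1 - γ` is at most itself, so `C` can be constant
  -- in `t`.
  refine ⟨γ, hmono, fun t ht => (hγ t ht).1, fun M _ => ⟨fun _ => max M 1,
    fun _ _ => by positivity, ?_⟩⟩
  intro f hf hfM x₀ hx₀ K a hK ha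
  have ha1 : 1 ≤ a := (le_max_right _ _).trans ha
  have ha2 : 2 * K ≤ a := (le_max_left _ _).trans ha
  have ha0 : 0 < a := by linarith
  set t := K / a with htdef
  have hat : a * t = K := by rw [htdef]; field_simp
  have ht : t ∈ Ioc (0 : ℝ) (1 / 2) :=
    ⟨by positivity, by rw [htdef, div_le_div_iff₀ ha0 two_pos]; linarith⟩
  obtain ⟨⟨hγ0, hγ1⟩, s, hs, hγs⟩ := hγ t ht
  have hs' : s ∈ Ioc (0 : ℝ) (1 / 2) := ⟨hs.1, hs.2.trans ht.2⟩
  have hdiff := hf.differentiable_complexFarField hR0.le hx₀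
  have hcont : Continuous fun k : ℝ => farField f x₀ k :=
    hdiff.continuous.comp Complex.continuous_ofReal
  have hMle : ∀ k : ℝ, ‖farField f x₀ k‖ ≤ max M 1 := fun k => by
    have := hf.norm_complexFarField_le hx₀ k
    rw [Complex.ofReal_im, abs_zero, mul_zero, Real.exp_zero, one_mul] at this
    exact this.trans (hfM.trans (le_max_left _ _))
  set E := eLpNorm (fun k : ℝ => farField f x₀ k) ∞ (volume.restrict (Ioo 0 K)) with hE
  have hEle : E ≤ ENNReal.ofReal (max M 1) := by
    rw [hE, eLpNorm_exponent_top]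
    exact eLpNormEssSup_le_of_ae_bound (.of_forall hMle)
  have hEtop : E ≠ ∞ := ne_top_of_le_ne_top ENNReal.ofReal_ne_top hEle
  set e := E.toReal with he
  have he0 : 0 ≤ e := ENNReal.toReal_nonneg
  have heM : e ≤ max M 1 := ENNReal.toReal_le_of_le_ofReal (by positivity) hEle
  have hsmall : ∀ k ∈ Icc 0 K, ‖farField f x₀ k‖ ≤ e := fun k hk => by
    have := ENNReal.toReal_mono hEtop (hcont.enorm_le_eLpNorm_top_Ioo hK hk)
    rwa [toReal_enorm] at this
  set B := max M 1 * Real.exp a with hB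
  have hB0 : 0 < B := by positivity
  have heB : e ≤ B := heM.trans (le_mul_of_one_le_right (by positivity)
    (Real.one_le_exp ha0.le))
  set G : ℂ → ℂ := fun z => complexFarField f x₀ (a * z + (K / 2 : ℝ)) with hG
  have hGreal : ∀ x : ℝ, G x = farField f x₀ (a * x + K / 2) := fun x => by
    rw [← complexFarField_ofReal, hG]
    push_cast
    rfl
  have hbound : ∀ k ∈ Ioo (-a) a, ‖farField f x₀ k‖ ≤ e ^ q s * B ^ (1 - q s) := by
    intro k hk
    -- The exponent for `s ≤ t` applies because its segment `|x| ≤ s/2` lies in the one where `G` is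
    -- small.
    have h1 := (hq s hs').2 G (hdiff.comp (by fun_prop)) e B he0 heB hB0 ?_ ?_
      ((k - K / 2) / a) ?_
    · rwa [hGreal, mul_div_cancel₀ _ ha0.ne', sub_add_cancel] at h1
    · intro z hz
      refine (hf.norm_complexFarField_le hx₀ _).trans ?_
      rw [hB, mul_comm (max M 1)]
      have him : (a * z + (K / 2 : ℝ) : ℂ).im = a * z.im := by
        rw [Complex.add_im, Complex.ofReal_im, add_zero, Complex.im_ofReal_mul]
      refine mul_le_mul (Real.exp_le_exp.2 ?_) (hfM.trans (le_max_left _ _))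
        (integral_nonneg fun _ => norm_nonneg _) (Real.exp_pos _).le
      rw [him, abs_mul, abs_of_pos ha0]
      calc R * (a * |z.im|) ≤ R * (a * R⁻¹) := by gcongr
        _ = a := by field_simp
    · intro x hx
      rw [hGreal]
      have hx' := abs_le.1 hx
      refine hsmall _ ⟨?_, ?_⟩ <;> nlinarith [hs.2]
    · rw [abs_div, abs_of_pos ha0, div_le_iff₀ ha0, abs_le]
      constructor <;> linarith [hk.1, hk.2]
  have hfinal : ∀ k ∈ Ioo (-a) a,
      ‖farField f x₀ k‖ ≤ max M 1 * Real.exp (a * (1 - γ t)) * e ^ γ t := by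
    intro k hk
    refine (hbound k hk).trans ((rpow_interp_anti he0 heB hB0 hγ0.le hγs).trans ?_)
    rw [mul_comm, hB, Real.mul_rpow (by positivity) (by positivity), ← Real.exp_mul]
    gcongr
    exact Real.rpow_le_self_of_one_le (le_max_right _ _) (by linarith)
  have hRHS : ENNReal.ofReal (max M 1 * Real.exp (a * (1 - γ t))) * E ^ γ t
      = ENNReal.ofReal (max M 1 * Real.exp (a * (1 - γ t)) * e ^ γ t) := by
    rw [ENNReal.ofReal_mul (p := max M 1 * Real.exp (a * (1 - γ t))) (by positivity),
      ← ENNReal.ofReal_rpow_of_nonneg he0 hγ0.le, he, ENNReal.ofReal_toReal hEtop]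
  rw [hRHS, eLpNorm_exponent_top]
  refine eLpNormEssSup_le_of_ae_bound ?_
  rw [ae_restrict_iff' measurableSet_Ioo]
  exact .of_forall hfinal
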